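/- Consider a network with base stations (BSs) $\mathcal N=\{0,1,\dots,N\}$, where BS $0$ is the macro base station (MBS) and the BSs in $\mathcal N^+=\{1,\dots,N\}$ are small base stations (SBSs), and with contents $\mathcal M=\{1,\dots,M\}$. BS $n$ caches a set $\mathcal M_n\subseteq\mathcal M$, with $\mathcal M_0=\mathcal M$; put $\mathcal N_m=\{n\in\mathcal N^+: m\in\mathcal M_n\}$. For $n\in\mathcal N$ and $m\in\mathcal M_n$ there is a request queue $(n,m)$ with finite upper limit $N_{n,m}\in\{0,1,\dots\}$; the state space is $\boldsymbol{\mathcal Q}=\prod_{n\in\mathcal N}\prod_{m\in\mathcal M_n}\{0,1,\dots,N_{n,m}\}$. The feasible action space is $$\boldsymbol{\mathcal U}=\Big\{(u_n)_{n\in\mathcal N}: u_n\in\mathcal M_n\cup\{0\}\ \forall n\in\mathcal N,\ u_0\sum_{n\in\mathcal N^+}u_n=0\Big\},$$ where $u_n=0$ means that BS $n$ is idle. Let $p(n,m)$ ($n\in\mathcal N$, $m\in\mathcal M_n$) be real transmission powers, $p(n,0)=0$, let $w$ be a real weight, and let $$g(\mathbf Q,\mathbf u)=\sum_{n\in\mathcal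 N}\sum_{m\in\mathcal M_n}Q_{n,m}+w\sum_{n\in\mathcal N}p(n,u_n).$$ Let $\mathbf A=(A_{n,m})_{n\in\mathcal N,m\in\mathcal M}$ be the random request arrivals of one slot, which are independent random variables with values in $\{0,1,2,\dots\}$ and arbitrary laws, and put $\tilde A_{0,m}=A_{0,m}+\sum_{n\in\mathcal N^+\setminus\mathcal N_m}A_{n,m}$. For $\mathbf Q\in\boldsymbol{\mathcal Q}$ and $\mathbf u\in\boldsymbol{\mathcal U}$ the next state $\mathbf Q'$ is given by $$Q'_{0,m}=\min\{\mathbf 1(u_0\ne m)Q_{0,m}+\tilde A_{0,m},N_{0,m}\}\quad(m\in\mathcal M_0),$$ $$Q'_{n,m}=\min\{\mathbf 1(u_0\ne m\ \&\ u_n\ne m)Q_{n,m}+A_{n,m},N_{n,m}\}\quad(n\in\mathcal N^+,\ m\in\mathcal M_n).$$ Let $\theta\in\mathbb R$ and $V:\boldsymbol{\mathcal Q}\to\mathbb R$ (the value function) be any solution of the Bellman equation $$\theta+V(\mathbf Q)=\min_{\mathbf u\in\boldsymbol{\mathcal U}}\big\{g(\mathbf Q,\mathbf u)+\mathbb E[V(\mathbf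 Q')]\big\}\qquad\forall\,\mathbf Q\in\boldsymbol{\mathcal Q},$$ and define $J(\mathbf Q,\mathbf u)=g(\mathbf Q,\mathbf u)+\mathbb E[V(\mathbf Q')]$ and $\Delta_{\mathbf u,\mathbf v}(\mathbf Q)=J(\mathbf Q,\mathbf u)-J(\mathbf Q,\mathbf v)$. Lemma 3 (Monotonicity of $\Delta_{\mathbf u,\mathbf v}(\mathbf Q)$). For all $\mathbf u,\mathbf v\in\boldsymbol{\mathcal U}$: 1. If $u_0=m\in\mathcal M_0$, then $\Delta_{\mathbf u,\mathbf v}(\mathbf Q)$ is monotonically non-increasing in $Q_{0,m}$, and in $Q_{n,m}$ for every $n\in\mathcal N_m$. 2. If $u_n=m\in\mathcal M_n$ for some $n\in\mathcal N^+$, then $\Delta_{\mathbf u,\mathbf v}(\mathbf Q)$ is monotonically non-increasing in $Q_{n,m}$. Here monotonicity in one coordinate is understood on $\{0,\dots,N_{n,m}\}$ with all other coordinates of $\mathbf Q\in\boldsymbol{\mathcal Q}$ fixed at arbitrary values. -/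

import Mathlib

open MeasureTheory Finset

noncomputable section

/-- A cache-enabled heterogeneous network with base stations `0, …, N` (base station `0` is the
MBS, the others are the SBSs) and `M` contents. Only the entries of `cap` and `power` at pairs
`(n, m)` with `m ∈ cache n` are ever used. -/
structure HetNet (N M : ℕ) where
  /-- the set of contents cached at each base station -/
  cache : Fin (N + 1) → Finset (Fin M)
  /-- the MBS stores all contents -/
  cache_zero : cache 0 = Finset.univ
  /-- the (finite) upper limit of the counter of queue `(n, m)` -/
  cap : Fin (N + 1) → Fin M → ℕ
  /-- the transmission power needed by base station `n` to deliver content `m` -/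
  power : Fin (N + 1) → Fin M → ℝ
  /-- the law of the number of requests per slot for content `m` from the users of area `n` -/
  arrival : Fin (N + 1) → Fin M → PMF ℕ
  /-- the weight of the power cost relative to the delay cost -/
  w : ℝ

namespace HetNet

variable {N M : ℕ} (H : HetNet N M)

/-- The queues: pairs `(n, m)` where content `m` is cached at base station `n`. -/
abbrev Queue : Type := {q : Fin (N + 1) × Fin M // q.2 ∈ H.cache q.1}

/-- The queue `(0, m)` of the MBS. -/
def mbsQueue (m : Fin M) : H.Queue := ⟨(0, m), by rw [H.cache_zero]; exact Finset.mem_univ m⟩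

/-- The SBSs caching content `m`. -/
def sbsCaching (m : Fin M) : Finset (Fin (N + 1)) := {n | n ≠ 0 ∧ m ∈ H.cache n}

/-- The queue `(n, m)` of an SBS `n` caching content `m`. -/
def sbsQueue (n : Fin (N + 1)) (m : Fin M) (h : m ∈ H.cache n) : H.Queue := ⟨(n, m), h⟩

/-- The request queue state space: the length of queue `(n, m)` ranges over
`{0, …, cap n m}`. -/
abbrev State : Type := (q : H.Queue) → Fin (H.cap q.1.1 q.1.2 + 1)

/-- The feasible actions `u`: `u n = some m` means that base station `n` multicasts its cached
content `m`, and `u n = none` that it is idle. The MBS and the SBSs do not operate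
concurrently. -/
abbrev Action : Type :=
  {u : Fin (N + 1) → Option (Fin M) //
    (∀ n m, u n = some m → m ∈ H.cache n) ∧ (u 0 = none ∨ ∀ n, n ≠ 0 → u n = none)}

/-- The sum request queue length (delay cost) `d(Q)`. -/
def delayCost (Q : H.State) : ℝ := ∑ q : H.Queue, ((Q q : ℕ) : ℝ)

/-- The network power cost `p(u)`; an idle base station uses no power. -/
def powerCost (u : H.Action) : ℝ := ∑ n, (u.1 n).elim 0 (H.power n)

/-- The per-stage network cost `g(Q, u) = d(Q) + w p(u)`. -/
def stageCost (Q : H.State) (u : H.Action) : ℝ := H.delayCost Q + H.w * H.powerCost u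

/-- The law of the request arrival matrix of one slot: independent entries with the given
laws. -/
def arrivalLaw : Measure (Fin (N + 1) × Fin M → ℕ) :=
  Measure.pi fun i => (H.arrival i.1 i.2).toMeasure

/-- The number of new requests entering a queue when the arrival matrix is `A`. The queue `(0, m)`
also receives the requests for `m` from the areas of those SBSs that do not cache `m`. -/
def incoming (A : Fin (N + 1) × Fin M → ℕ) (q : H.Queue) : ℕ :=
  if q.1.1 = 0 then
    (∑ n with n ≠ 0 ∧ q.1.2 ∉ H.cache n, A (n, q.1.2)) + A (0, q.1.2)
  else A q.1

/-- The queue state after one slot: queue `(n, m)` is emptied if content `m` is multicast by the MBS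
or by base station `n` itself, then the new requests are added, up to the upper limit. -/
def next (Q : H.State) (u : H.Action) (A : Fin (N + 1) × Fin M → ℕ) : H.State := fun q =>
  ⟨min ((if u.1 0 ≠ some q.1.2 ∧ u.1 q.1.1 ≠ some q.1.2 then (Q q : ℕ) else 0) + H.incoming A q)
      (H.cap q.1.1 q.1.2),
    Nat.lt_succ_of_le (min_le_right _ _)⟩

/-- The state-action cost `J(Q, u) = g(Q, u) + 𝔼[V(Q')]`, with the expectation over the arrivals of
the slot. -/
def stateActionCost (V : H.State → ℝ) (Q : H.State) (u : H.Action) : ℝ :=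
  H.stageCost Q u + ∫ A, V (H.next Q u A) ∂H.arrivalLaw

/-- `(θ, V)` solves the Bellman equation `θ + V(Q) = min_u {g(Q, u) + 𝔼[V(Q')]}` for all `Q`, the
minimum being over all feasible actions. -/
def SolvesBellman (θ : ℝ) (V : H.State → ℝ) : Prop :=
  ∀ Q : H.State, IsLeast (Set.range fun u : H.Action => H.stateActionCost V Q u) (θ + V Q)

/-- `Δ_{u,v}(Q) = J(Q, u) - J(Q, v)`. -/
def delta (V : H.State → ℝ) (u v : H.Action) (Q : H.State) : ℝ :=
  H.stateActionCost V Q u - H.stateActionCost V Q v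

end HetNet

end

namespace HetNet

variable {N M : ℕ} (H : HetNet N M)

/-! The delay costs cancel in `delta`, and the expectation under `u` does not see a queue that `u`
serves. Only `-𝔼[V(Q')]` under `v` still varies with that queue, so the claim reduces to
monotonicity of `V`. This follows from the Bellman equation by a maximum principle on ordered pairs
of states, without value iteration. -/

instance isProbabilityMeasure_arrivalLaw : IsProbabilityMeasure H.arrivalLaw := by
  unfold arrivalLaw
  infer_instance

/-- The expected value of the next state is the integral of a bounded function. -/
theorem integrable_next (V : H.State → ℝ) (Q : H.State) (u : H.Action) :
    Integrable (fun A => V (H.next Q u A)) H.arrivalLaw := by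
  obtain ⟨C, hC⟩ := (Set.finite_range fun Q => ‖V Q‖).bddAbove
  exact Integrable.of_bound (Measurable.of_discrete).aestronglyMeasurable C
    (Filter.Eventually.of_forall fun A => hC ⟨_, rfl⟩)

/-- Coupling: both states see the same action and the same arrivals. -/
theorem next_mono {Q Q' : H.State} (h : Q ≤ Q') (u : H.Action)
    (A : Fin (N + 1) × Fin M → ℕ) : H.next Q u A ≤ H.next Q' u A := by
  intro q
  have hq : (Q q : ℕ) ≤ Q' q := h q
  refine Fin.mk_le_mk.2 (min_le_min_right _ ?_)
  gcongr
  split_ifs <;> simp [hq]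

/-- Strictness is what makes the maximum principle below contradictory off the diagonal. -/
theorem delayCost_strictMono : StrictMono H.delayCost := by
  intro Q Q' h
  obtain ⟨hle, q, hq⟩ := Pi.lt_def.1 h
  refine Finset.sum_lt_sum (fun r _ => ?_) ⟨q, Finset.mem_univ q, ?_⟩
  · exact_mod_cast hle r
  · exact_mod_cast hq

/-- Every solution of the Bellman equation is monotone in the queue state. -/
theorem SolvesBellman.monotone {H : HetNet N M} {θ : ℝ} {V : H.State → ℝ}
    (hV : H.SolvesBellman θ V) : Monotone V := by
  -- The ordered pair violating monotonicity the most; it will turn out to be diagonal, so the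
  -- largest violation is `0`.
  obtain ⟨⟨P, P'⟩, hP, hmax⟩ := Set.exists_max_image
    {p : H.State × H.State | p.1 ≤ p.2} (fun p => V p.1 - V p.2) (Set.toFinite _)
    ⟨(fun _ => 0, fun _ => 0), le_refl (fun _ => 0 : H.State)⟩
  have hPP : P = P' := by
    by_contra hne
    have hd := H.delayCost_strictMono (lt_of_le_of_ne hP hne)
    -- An action optimal at `P'` is merely feasible at `P`, so `V P - V P'` is at most the delay
    -- cost difference, which is negative, plus the expected violation one slot later.
    obtain ⟨u, hu⟩ := (hV P').1
    have hu' := (hV P).2 ⟨u, rfl⟩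
    -- The successors are again ordered, so maximality bounds the integrand pointwise.
    have hint : ∫ A, (V (H.next P u A) - V (H.next P' u A)) ∂H.arrivalLaw ≤ V P - V P' := by
      calc _ ≤ ∫ _, (V P - V P') ∂H.arrivalLaw :=
            integral_mono ((H.integrable_next V P u).sub (H.integrable_next V P' u))
              (integrable_const _) fun A => hmax (_, _) (H.next_mono hP u A)
        _ = _ := by simp
    rw [integral_sub (H.integrable_next V P u) (H.integrable_next V P' u)] at hint
    simp only [stateActionCost, stageCost] at hu hu'
    linarith
  intro Q Q' h
  have := hmax (Q, Q') h
  simp only [hPP, sub_self] at this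
  linarith

/-- When the action serves a queue, its length does not influence the next state. -/
theorem next_update_of_served (Q : H.State) (u : H.Action) (A : Fin (N + 1) × Fin M → ℕ)
    {q : H.Queue} (hq : u.1 0 = some q.1.2 ∨ u.1 q.1.1 = some q.1.2)
    (x y : Fin (H.cap q.1.1 q.1.2 + 1)) :
    H.next (Function.update Q q x) u A = H.next (Function.update Q q y) u A := by
  funext r
  by_cases hr : r = q
  · subst hr
    have : ¬ (u.1 0 ≠ some r.1.2 ∧ u.1 r.1.1 ≠ some r.1.2) := by tauto
    simp only [next, if_neg this]
  · simp only [next, Function.update_of_ne hr]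

/-- `Δ_{u,v}` is non-increasing in the length of every queue that `u` serves. -/
theorem SolvesBellman.antitone_delta {H : HetNet N M} {θ : ℝ} {V : H.State → ℝ}
    (hV : H.SolvesBellman θ V) (Q : H.State) (u v : H.Action) {q : H.Queue}
    (hq : u.1 0 = some q.1.2 ∨ u.1 q.1.1 = some q.1.2) :
    Antitone fun x => H.delta V u v (Function.update Q q x) := by
  intro x y hxy
  have hle : Function.update Q q x ≤ Function.update Q q y :=
    Function.update_mono hxy
  have hint := integral_mono (H.integrable_next V (Function.update Q q x) v)
    (H.integrable_next V (Function.update Q q y) v)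
    fun A => hV.monotone (H.next_mono hle v A)
  -- The two expectations under `u` become identical; only `hint` is left to use.
  simp only [delta, stateActionCost, stageCost, H.next_update_of_served Q u _ hq y x]
  linarith

end HetNet

theorem lemma3 {N M : ℕ} (H : HetNet N M) (θ : ℝ) (V : H.State → ℝ)
    (hV : H.SolvesBellman θ V) (Q : H.State) (u v : H.Action) :
    (∀ m : Fin M, u.1 0 = some m →
      Antitone (fun x => H.delta V u v (Function.update Q (H.mbsQueue m) x)) ∧
      ∀ n : Fin (N + 1), n ∈ H.sbsCaching m → ∀ hm : m ∈ H.cache n,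
        Antitone (fun x => H.delta V u v (Function.update Q (H.sbsQueue n m hm) x))) ∧
    (∀ (n : Fin (N + 1)) (m : Fin M) (hm : m ∈ H.cache n), n ≠ 0 → u.1 n = some m →
      Antitone (fun x => H.delta V u v (Function.update Q (H.sbsQueue n m hm) x))) :=
  ⟨fun _ hu => ⟨hV.antitone_delta Q u v (Or.inl hu),
      fun _ _ _ => hV.antitone_delta Q u v (Or.inl hu)⟩,
    fun _ _ _ _ hu => hV.antitone_delta Q u v (Or.inr hu)⟩
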